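/- Conventions. Functions are complex valued on $\mathbb R^3$. The support of a function is its essential support, i.e. the complement of the largest open set on which it vanishes almost everywhere, and the distance of two sets is $+\infty$ if one of them is empty. If $m$ is smooth on $\mathbb R^3\setminus\{0\}$ and homogeneous of degree zero, i.e. $m(\lambda\xi)=m(\xi)$ for all $\lambda>0$, then $m$ is bounded on $\mathbb R^3\setminus\{0\}$, and the operator $T$ with Fourier symbol $m$ is defined on $L^1(\mathbb R^3)$ by $Tf=\mathcal F^{-1}(m\,\mathcal Ff)$, which is a tempered distribution. For a tempered distribution $u$ and $g\in L^1(\mathbb R^3)$ the pairing $\langle u,g\rangle$ is defined if $u$ is given, on some open neighbourhood of $\operatorname{supp} g$, by a locally integrable function $h$ such that $hg$ is integrable, and then $\langle u,g\rangle=\int hg\,dx$ (no complex conjugation). $\mathcal R_j$ is the Riesz transform, with symbol $-i\xi_j/|\xi|$; products of powers of Riesz transforms are the operators whose symbols are the corresponding products of powers. For $x\in\mathbb R^3$, $\bar x=(x_1,x_2)$. (1) Let $T$ be the operator on $\mathbb R^3$ with Fourier symbol $m$, where $m:\mathbb R^3\setminus\{0\}\to\mathbb C$ is smooth and homogeneous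 of degree zero. There is a constant $C\in(0,\infty)$ depending only on $m$ such that for all $f,g\in L^1(\mathbb R^3)$ with disjoint supports: $\langle Tf,g\rangle$ is defined whenever $\operatorname{dist}(\operatorname{supp} f,\operatorname{supp} g)>0$, and whenever it is defined, $$|\langle Tf,g\rangle|\le C\,\operatorname{dist}(\operatorname{supp} f,\operatorname{supp} g)^{-3}\,\|g\|_{L^1}\|f\|_{L^1}$$ (with $0^{-3}=\infty$, $\infty^{-3}=0$; for disjoint supports at distance zero nothing is asserted). (2) For every $i\in\{1,2,3\}$ and $d>0$ there is a constant $C\in(0,\infty)$ such that for all $\gamma_1,\gamma_2>0$ with $\gamma_2-\gamma_1=d$, all $R>0$, and all $f,g\in L^1(\mathbb R^3)$ with $f$ supported in $\{|\bar x|\ge\gamma_2R\}$ and $g$ supported in $\{|\bar x|\le\gamma_1R\}$, the pairing $\langle\mathcal R_i^4f,g\rangle$ is defined and $$|\langle\mathcal R_i^4f,g\rangle|\le C R^{-3}\|g\|_{L^1}\|f\|_{L^1}.$$ (3) For every $k,h\in\{1,2,3\}$ and $d>0$ there is a constant $C\in(0,\infty)$ such that, for all $\gamma_1,\gamma_2,R,f,g$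 as in (2), the pairing $\langle\mathcal R_k^2\mathcal R_h^2f,g\rangle$ is defined and $$|\langle\mathcal R_k^2\mathcal R_h^2f,g\rangle|\le C R^{-3}\|g\|_{L^1}\|f\|_{L^1}.$$ -/

import Mathlib

open MeasureTheory FourierTransform SchwartzMap
open scoped ENNReal NNReal ContDiff

namespace ZeroDegree

/-- Three dimensional Euclidean space. -/
abbrev R3 : Type := EuclideanSpace ℝ (Fin 3)

/-- `m` is smooth on `ℝ³ \ {0}` and homogeneous of degree zero.
The value `m 0` is irrelevant. -/
structure IsZeroDegreeSymbol (m : R3 → ℂ) : Prop where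
  smooth : ContDiffOn ℝ ∞ m {0}ᶜ
  homogeneous : ∀ r : ℝ, 0 < r → ∀ ξ : R3, m (r • ξ) = m ξ

namespace IsZeroDegreeSymbol

theorem mul {m n : R3 → ℂ} (hm : IsZeroDegreeSymbol m) (hn : IsZeroDegreeSymbol n) :
    IsZeroDegreeSymbol (m * n) where
  smooth := hm.smooth.mul hn.smooth
  homogeneous r hr ξ := by
    simp only [Pi.mul_apply, hm.homogeneous r hr ξ, hn.homogeneous r hr ξ]

theorem pow {m : R3 → ℂ} (hm : IsZeroDegreeSymbol m) (k : ℕ) :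
    IsZeroDegreeSymbol (m ^ k) where
  smooth := hm.smooth.pow k
  homogeneous r hr ξ := by
    simp only [Pi.pow_apply, hm.homogeneous r hr ξ]

/-- A zero degree symbol is essentially bounded. -/
theorem memLp_top {m : R3 → ℂ} (hm : IsZeroDegreeSymbol m) : MemLp m ∞ (volume : Measure R3) := by
  have hc : ContinuousOn m {0}ᶜ := hm.smooth.continuousOn
  have hsub : Metric.sphere (0 : R3) 1 ⊆ {0}ᶜ := by
    intro x hx h0
    rw [Set.mem_singleton_iff] at h0
    simp [h0] at hx
  obtain ⟨C, hC⟩ := (isCompact_sphere (0 : R3) 1).exists_bound_of_continuousOn (hc.mono hsub)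
  have hne : ∀ᵐ ξ : R3 ∂volume, ξ ∈ ({0}ᶜ : Set R3) := by
    rw [ae_iff]
    simp
  refine memLp_top_of_bound ?_ C ?_
  · have h := hc.aestronglyMeasurable (μ := volume) (measurableSet_singleton (0 : R3)).compl
    rwa [Measure.restrict_eq_self_of_ae_mem hne] at h
  · filter_upwards [hne] with ξ hξ
    have hpos : 0 < ‖ξ‖ := norm_pos_iff.mpr hξ
    rw [← hm.homogeneous ‖ξ‖⁻¹ (inv_pos.mpr hpos) ξ]
    apply hC
    simp [norm_smul, hpos.ne']

/-- If `m` is a zero degree symbol and `f ∈ L¹`, then `m · 𝓕 f` is essentially bounded. -/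
theorem memLp_mul_fourier {m : R3 → ℂ} (hm : IsZeroDegreeSymbol m) {f : R3 → ℂ}
    (hf : Integrable f) : MemLp (fun ξ ↦ m ξ * 𝓕 f ξ) ∞ (volume : Measure R3) := by
  have h2 : MemLp (𝓕 f) ∞ (volume : Measure R3) := by
    refine memLp_top_of_bound ?_ (∫ v, ‖f v‖) (Filter.Eventually.of_forall fun ξ ↦ ?_)
    · exact (VectorFourier.fourierIntegral_continuous Real.continuous_fourierChar
        (by exact continuous_inner) hf).aestronglyMeasurable
    · exact VectorFourier.norm_fourierIntegral_le_integral_norm _ _ _ _ _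
  exact h2.mul hm.memLp_top

end IsZeroDegreeSymbol

/-- The operator `T` with Fourier symbol `m`, on `L¹`: `T f = 𝓕⁻¹ (m · 𝓕 f)`, where `𝓕 f` is the
Fourier integral of `f`, the bounded function `m · 𝓕 f` is regarded as a tempered distribution, and
`𝓕⁻¹` is the inverse Fourier transform of tempered distributions. Since `m` is homogeneous of degree
zero, `T` is the same operator for the normalization `∫ exp (-i x·ξ) f(x) dx` of the
Fourier transform as for Mathlib's normalization `∫ exp (-2π i x·ξ) f(x) dx`. -/
noncomputable def multiplierOp (m : R3 → ℂ) (hm : IsZeroDegreeSymbol m)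
    (f : R3 → ℂ) (hf : Integrable f) : 𝓢'(R3, ℂ) :=
  𝓕⁻ (((hm.memLp_mul_fourier hf).toLp (fun ξ ↦ m ξ * 𝓕 f ξ) : Lp ℂ ∞ (volume : Measure R3)) :
    𝓢'(R3, ℂ))

/-- The support of a (class of a) measurable function: the complement of the
largest open set on which `f` vanishes almost everywhere. -/
def essSupport (f : R3 → ℂ) : Set R3 :=
  {x | ∀ U ∈ nhds x, ¬ f =ᵐ[volume.restrict U] 0}

/-- The distance of two sets, with value `∞` if one of them is empty. -/
noncomputable def setEDist (s t : Set R3) : ℝ≥0∞ :=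
  ⨅ x ∈ s, ⨅ y ∈ t, edist x y

/-- On the open set `U`, the distribution `u` is given by the locally integrable function `h`. -/
def RepresentedOn (u : 𝓢'(R3, ℂ)) (h : R3 → ℂ) (U : Set R3) : Prop :=
  LocallyIntegrableOn h U ∧
    ∀ φ : 𝓢(R3, ℂ), HasCompactSupport φ → tsupport φ ⊆ U → u φ = ∫ x, h x * φ x

/-- `⟨u, g⟩ = z` in the sense `∫ u g dx = z`: the distribution `u` is given on some
open neighbourhood of the support of `g` by a locally integrable function `h` such that `h g` is
integrable, and `z = ∫ h g`. The pairing is bilinear (no complex conjugation). -/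
def HasPairing (u : 𝓢'(R3, ℂ)) (g : R3 → ℂ) (z : ℂ) : Prop :=
  ∃ (U : Set R3) (h : R3 → ℂ), IsOpen U ∧ essSupport g ⊆ U ∧ RepresentedOn u h U ∧
    Integrable (fun x ↦ h x * g x) ∧ z = ∫ x, h x * g x

/-- The symbol `-i ξⱼ / |ξ|` of the `j`-th Riesz transform. -/
noncomputable def rieszSymbol (j : Fin 3) (ξ : R3) : ℂ :=
  -Complex.I * (((ξ j / ‖ξ‖ : ℝ)) : ℂ)

theorem isZeroDegreeSymbol_riesz (j : Fin 3) : IsZeroDegreeSymbol (rieszSymbol j) where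
  smooth := by
    have h1 : ContDiffOn ℝ ∞ (fun ξ : R3 ↦ ξ j / ‖ξ‖) {0}ᶜ := by
      refine ContDiffOn.div (by fun_prop) (fun x hx ↦ ?_) (fun x hx ↦ norm_ne_zero_iff.mpr hx)
      exact (contDiffAt_norm ℝ hx).contDiffWithinAt
    exact contDiffOn_const.mul (Complex.ofRealCLM.contDiff.comp_contDiffOn h1)
  homogeneous r hr ξ := by
    simp only [rieszSymbol, PiLp.smul_apply, smul_eq_mul, norm_smul, Real.norm_eq_abs,
      abs_of_pos hr, mul_div_mul_left _ _ hr.ne']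

/-- `|x̄|`, where `x̄ = (x₁, x₂)`: the distance of `x` to the third axis. -/
noncomputable def cylRadius (x : R3) : ℝ := Real.sqrt (x 0 ^ 2 + x 1 ^ 2)

end ZeroDegree

open ZeroDegree

/-!
Cut `m` off by a dyadic partition of unity: `m ξ = ∑ₙ p (2ⁿ ξ)` for `ξ ≠ 0`, with a single test
function `p` supported in an annulus. The inverse Fourier transforms of the summands are dilates of
the Schwartz function `𝓕⁻ p`, and they add up absolutely, away from the origin, to a kernel `K`
with `|K x| ≤ C |x|⁻³`. Since a test function `φ` whose support does not contain `y` only sees `K`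
away from the origin in `𝓕 (m · 𝓕⁻ φ) y = ∫ K (x - y) φ x dx`, the distribution `T f` is given by
the convolution of `f` with `K` off the support of `f`; the locally integrable function
representing a distribution being unique almost everywhere, every admissible pairing is
`∫ (f ⋆ K) g`, and the size of `K` bounds it. A multiple of the Dirac mass at the origin, which `K`
does not see, never contributes. For the cylinders it remains to note that the two supports are at
distance at least `d R`, because `|x̄|` is a `1`-Lipschitz function.
-/

namespace ZeroDegree

open Filter Topology

theorem hasSum_half_pow_natAbs : HasSum (fun n : ℤ ↦ (1 / 2 : ℝ) ^ n.natAbs) 3 := by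
  have h := HasSum.of_nat_of_neg (f := fun n : ℤ ↦ (1 / 2 : ℝ) ^ n.natAbs)
    (by simpa using hasSum_geometric_two) (by simpa using hasSum_geometric_two)
  rwa [Int.natAbs_zero, pow_zero, show (2 + 2 - 1 : ℝ) = 3 by norm_num] at h

theorem min_zpow_mul_inv_le {r : ℝ} (hr : 1 ≤ r) (hr' : r < 2) (n : ℤ) :
    min (2 ^ n * r) (2 ^ n * r)⁻¹ ≤ 2 * (1 / 2) ^ n.natAbs := by
  obtain ⟨k, rfl | rfl⟩ := n.eq_nat_or_neg
  · refine (min_le_right _ _).trans ?_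
    rw [mul_inv, zpow_natCast, Int.natAbs_natCast, one_div, inv_pow, mul_comm]
    gcongr
    exact (inv_le_one_of_one_le₀ hr).trans one_le_two
  · refine (min_le_left _ _).trans ?_
    rw [zpow_neg, zpow_natCast, Int.natAbs_neg, Int.natAbs_natCast, one_div, inv_pow, mul_comm]
    gcongr

theorem tsum_min_zpow_mul_inv_le {r : ℝ} (hr : 0 ≤ r) :
    ∑' n : ℤ, ENNReal.ofReal (min (2 ^ n * r) (2 ^ n * r)⁻¹) ≤ 6 := by
  rcases hr.eq_or_lt with rfl | hr
  · simp
  obtain ⟨k, hk, hk'⟩ := exists_mem_Ico_zpow hr one_lt_two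
  have h2k : (0 : ℝ) < 2 ^ k := zpow_pos two_pos k
  rw [zpow_add_one₀ two_ne_zero] at hk'
  calc ∑' n : ℤ, ENNReal.ofReal (min (2 ^ n * r) (2 ^ n * r)⁻¹)
      = ∑' n : ℤ, ENNReal.ofReal (min (2 ^ n * (r / 2 ^ k)) (2 ^ n * (r / 2 ^ k))⁻¹) := by
        rw [← (Equiv.subRight k).tsum_eq]
        simp only [Equiv.subRight_apply, zpow_sub₀ (two_ne_zero' ℝ), div_mul_eq_mul_div,
          mul_div_assoc]
    _ ≤ ∑' n : ℤ, ENNReal.ofReal (2 * (1 / 2) ^ n.natAbs) := by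
        gcongr with n
        refine min_zpow_mul_inv_le ((one_le_div h2k).mpr hk) ?_ n
        rwa [div_lt_iff₀ h2k, mul_comm]
    _ = 6 := by
        have h := hasSum_half_pow_natAbs.mul_left 2
        rw [← ENNReal.ofReal_tsum_of_nonneg (fun n ↦ by positivity) h.summable, h.tsum_eq]
        norm_num

section Dyadic

variable {E F : Type*} [NormedAddCommGroup E] [NormedSpace ℝ E] [NormedAddCommGroup F]
  [NormedSpace ℝ F]

theorem enorm_pow_mul_tsum_enorm_dilate_le {a : E → F} {A : ℝ} {d : ℕ}
    (ha : ∀ x, ‖x‖ ^ d * ‖a x‖ ≤ A * min ‖x‖ ‖x‖⁻¹) (x : E) :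
    ‖x‖ₑ ^ d * ∑' n : ℤ, ‖((2 : ℝ) ^ n) ^ d • a ((2 : ℝ) ^ n • x)‖ₑ ≤ 6 * ENNReal.ofReal A := by
  have hnorm (n : ℤ) : ‖(2 : ℝ) ^ n • x‖ = 2 ^ n * ‖x‖ := by
    rw [norm_smul, norm_zpow, Real.norm_two]
  calc ‖x‖ₑ ^ d * ∑' n : ℤ, ‖((2 : ℝ) ^ n) ^ d • a ((2 : ℝ) ^ n • x)‖ₑ
      = ∑' n : ℤ, ENNReal.ofReal (‖(2 : ℝ) ^ n • x‖ ^ d * ‖a ((2 : ℝ) ^ n • x)‖) := by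
        rw [← ENNReal.tsum_mul_left]
        refine tsum_congr fun n ↦ ?_
        rw [ENNReal.ofReal_mul (by positivity), ENNReal.ofReal_pow (norm_nonneg _), ofReal_norm,
          ofReal_norm, enorm_smul, enorm_smul, enorm_pow, mul_pow, mul_left_comm, mul_assoc]
    _ ≤ ∑' n : ℤ, ENNReal.ofReal A * ENNReal.ofReal (min (2 ^ n * ‖x‖) (2 ^ n * ‖x‖)⁻¹) := by
        gcongr with n
        rw [← ENNReal.ofReal_mul' (by positivity), ← hnorm]
        exact ENNReal.ofReal_le_ofReal (ha _)
    _ ≤ ENNReal.ofReal A * 6 := by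
        rw [ENNReal.tsum_mul_left]
        gcongr
        exact tsum_min_zpow_mul_inv_le (norm_nonneg x)
    _ = 6 * ENNReal.ofReal A := mul_comm _ _

theorem exists_norm_pow_mul_le_min (k : 𝓢(E, F)) {d : ℕ} (hd : d ≠ 0) :
    ∃ A : ℝ, 0 < A ∧ ∀ x, ‖x‖ ^ d * ‖k x‖ ≤ A * min ‖x‖ ‖x‖⁻¹ := by
  obtain ⟨e, rfl⟩ := Nat.exists_eq_succ_of_ne_zero hd
  obtain ⟨A, hA, h0⟩ := k.decay e 0
  obtain ⟨B, -, h2⟩ := k.decay (e + 2) 0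
  simp only [norm_iteratedFDeriv_zero] at h0 h2
  refine ⟨max A B, lt_max_of_lt_left hA, fun x ↦ ?_⟩
  rw [mul_min_of_nonneg _ _ (lt_max_of_lt_left hA).le, le_min_iff]
  constructor
  · rw [pow_succ, mul_right_comm]
    gcongr
    exact (h0 x).trans (le_max_left _ _)
  · rcases (norm_nonneg x).eq_or_lt with hx | hx
    · simp [← hx]
    rw [le_mul_inv_iff₀ hx]
    calc ‖x‖ ^ (e + 1) * ‖k x‖ * ‖x‖ = ‖x‖ ^ (e + 2) * ‖k x‖ := by ring
      _ ≤ max A B := (h2 x).trans (le_max_right _ _)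

end Dyadic

section Cutoff

variable {V : Type*} [NormedAddCommGroup V] [InnerProductSpace ℝ V] [FiniteDimensional ℝ V]

/-- A smooth bump function, equal to `1` on the unit ball and to `0` outside the ball of radius `2`,
from which the partition of unity is built. -/
noncomputable def unitBump : V → ℝ := (⟨1, 2, one_pos, one_lt_two⟩ : ContDiffBump (0 : V))

/-- A smooth function supported in the annulus `1 / 2 ≤ ‖ξ‖ ≤ 2`, whose dilates by the powers of `2`
add up to `1` away from the origin. -/
noncomputable def dyadicCutoff (ξ : V) : ℝ := unitBump ξ - unitBump ((2 : ℝ) • ξ)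

theorem unitBump_of_norm_le_one {ξ : V} (hξ : ‖ξ‖ ≤ 1) : unitBump ξ = 1 :=
  ContDiffBump.one_of_mem_closedBall _ (mem_closedBall_zero_iff.mpr hξ)

theorem unitBump_of_two_le_norm {ξ : V} (hξ : 2 ≤ ‖ξ‖) : unitBump ξ = 0 :=
  ContDiffBump.zero_of_le_dist _ (by rwa [dist_zero_right])

theorem contDiff_unitBump : ContDiff ℝ ∞ (unitBump : V → ℝ) :=
  ContDiffBump.contDiff _

theorem contDiff_dyadicCutoff : ContDiff ℝ ∞ (dyadicCutoff : V → ℝ) :=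
  contDiff_unitBump.sub (contDiff_unitBump.comp (contDiff_const_smul 2))

theorem dyadicCutoff_of_norm_le {ξ : V} (hξ : ‖ξ‖ ≤ 1 / 2) : dyadicCutoff ξ = 0 := by
  rw [dyadicCutoff, unitBump_of_norm_le_one (by linarith), unitBump_of_norm_le_one, sub_self]
  rw [norm_smul, Real.norm_two]
  linarith

theorem dyadicCutoff_of_two_le_norm {ξ : V} (hξ : 2 ≤ ‖ξ‖) : dyadicCutoff ξ = 0 := by
  rw [dyadicCutoff, unitBump_of_two_le_norm hξ, unitBump_of_two_le_norm, sub_self]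
  rw [norm_smul, Real.norm_two]
  linarith

theorem dyadicCutoff_eventuallyEq_zero : dyadicCutoff =ᶠ[𝓝 (0 : V)] 0 := by
  filter_upwards [Metric.closedBall_mem_nhds (0 : V) one_half_pos] with ξ hξ
  exact dyadicCutoff_of_norm_le (mem_closedBall_zero_iff.mp hξ)

theorem sum_dyadicCutoff (N : ℕ) (ξ : V) :
    ∑ n ∈ Finset.Ico (-N : ℤ) N, dyadicCutoff ((2 : ℝ) ^ n • ξ) =
      unitBump (((2 : ℝ) ^ N)⁻¹ • ξ) - unitBump ((2 : ℝ) ^ N • ξ) := by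
  have h := Finset.sum_Ico_int_sub N fun n : ℤ ↦ unitBump ((2 : ℝ) ^ n • ξ)
  rw [zpow_neg, zpow_natCast] at h
  rw [← h]
  refine Finset.sum_congr rfl fun n _ ↦ ?_
  rw [dyadicCutoff, smul_smul, ← zpow_one_add₀ two_ne_zero, add_comm]

theorem hasSum_dyadicCutoff {ξ : V} (hξ : ξ ≠ 0) :
    HasSum (fun n : ℤ ↦ dyadicCutoff ((2 : ℝ) ^ n • ξ)) 1 := by
  have hpos : 0 < ‖ξ‖ := norm_pos_iff.mpr hξ
  have hnorm (n : ℤ) : ‖(2 : ℝ) ^ n • ξ‖ = 2 ^ n * ‖ξ‖ := by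
    rw [norm_smul, norm_zpow, Real.norm_two]
  obtain ⟨N, hN⟩ := pow_unbounded_of_one_lt (max ‖ξ‖ (2 / ‖ξ‖)) one_lt_two
  obtain ⟨hN₁, hN₂⟩ := max_lt_iff.mp hN
  rw [div_lt_iff₀ hpos] at hN₂
  have hsum : ∑ n ∈ Finset.Ico (-N : ℤ) N, dyadicCutoff ((2 : ℝ) ^ n • ξ) = 1 := by
    rw [sum_dyadicCutoff, unitBump_of_norm_le_one, unitBump_of_two_le_norm, sub_zero]
    · simpa [norm_smul] using hN₂.le
    · rw [norm_smul, norm_inv, norm_pow, Real.norm_two, inv_mul_le_one₀ (by positivity)]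
      exact hN₁.le
  rw [← hsum]
  refine hasSum_sum_of_ne_finset_zero fun n hn ↦ ?_
  rw [Finset.mem_Ico, not_and_or, not_le, not_lt] at hn
  rcases hn with hn | hn
  · refine dyadicCutoff_of_norm_le ?_
    have h2n : (2 : ℝ) ^ n * 2 * 2 ^ N ≤ 1 := by
      rw [← zpow_natCast, ← zpow_add_one₀ two_ne_zero, ← zpow_add₀ two_ne_zero]
      exact zpow_le_one_of_nonpos₀ one_le_two (by lia)
    rw [hnorm]
    nlinarith [zpow_pos (two_pos (α := ℝ)) n]
  · refine dyadicCutoff_of_two_le_norm ?_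
    rw [hnorm]
    refine hN₂.le.trans ?_
    gcongr
    rw [← zpow_natCast]
    gcongr
    exact one_le_two

end Cutoff

namespace IsZeroDegreeSymbol

theorem contDiff_mul_dyadicCutoff {m : R3 → ℂ} (hm : IsZeroDegreeSymbol m) :
    ContDiff ℝ ∞ fun ξ ↦ m ξ * (dyadicCutoff ξ : ℂ) := by
  rw [contDiff_iff_contDiffAt]
  intro ξ
  rcases eq_or_ne ξ 0 with rfl | hξ
  · refine (contDiffAt_const (c := (0 : ℂ))).congr_of_eventuallyEq ?_
    filter_upwards [dyadicCutoff_eventuallyEq_zero] with ξ hξ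
    rw [hξ, Pi.zero_apply, Complex.ofReal_zero, mul_zero]
  · exact (hm.smooth.contDiffAt (isOpen_compl_singleton.mem_nhds hξ)).mul
      (Complex.ofRealCLM.contDiff.comp contDiff_dyadicCutoff).contDiffAt

theorem exists_dyadic_decomposition {m : R3 → ℂ} (hm : IsZeroDegreeSymbol m) :
    ∃ (p : 𝓢(R3, ℂ)) (A : ℝ), (∀ ξ, ‖p ξ‖ ≤ A * min ‖ξ‖ ‖ξ‖⁻¹) ∧
      ∀ ξ ≠ 0, HasSum (fun n : ℤ ↦ p ((2 : ℝ) ^ n • ξ)) (m ξ) := by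
  have hc : HasCompactSupport fun ξ ↦ m ξ * (dyadicCutoff ξ : ℂ) := by
    refine HasCompactSupport.intro (isCompact_closedBall (0 : R3) 2) fun ξ hξ ↦ ?_
    rw [mem_closedBall_zero_iff, not_le] at hξ
    rw [dyadicCutoff_of_two_le_norm hξ.le, Complex.ofReal_zero, mul_zero]
  let p : 𝓢(R3, ℂ) := hc.toSchwartzMap hm.contDiff_mul_dyadicCutoff
  have hp (ξ : R3) : p ξ = m ξ * (dyadicCutoff ξ : ℂ) := rfl
  obtain ⟨B, hB, hpB⟩ := p.decay 0 0
  simp only [pow_zero, one_mul, norm_iteratedFDeriv_zero] at hpB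
  refine ⟨p, 2 * B, fun ξ ↦ ?_, fun ξ hξ ↦ ?_⟩
  · have hzero : dyadicCutoff ξ = 0 → ‖p ξ‖ ≤ 2 * B * min ‖ξ‖ ‖ξ‖⁻¹ := fun h ↦ by
      rw [hp, h, Complex.ofReal_zero, mul_zero, norm_zero]
      positivity
    rcases le_total ‖ξ‖ (1 / 2) with h₁ | h₁
    · exact hzero (dyadicCutoff_of_norm_le h₁)
    rcases le_total 2 ‖ξ‖ with h₂ | h₂
    · exact hzero (dyadicCutoff_of_two_le_norm h₂)
    have hmin : 1 / 2 ≤ min ‖ξ‖ ‖ξ‖⁻¹ :=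
      le_min h₁ (by rw [one_div]; exact inv_anti₀ (by linarith) h₂)
    calc ‖p ξ‖ ≤ B := hpB ξ
      _ = 2 * B * (1 / 2) := by ring
      _ ≤ 2 * B * min ‖ξ‖ ‖ξ‖⁻¹ := by gcongr
  · have h := (Complex.hasSum_ofReal.mpr (hasSum_dyadicCutoff hξ)).mul_left (m ξ)
    rw [Complex.ofReal_one, mul_one] at h
    simpa only [hp, hm.homogeneous _ (zpow_pos two_pos _)] using h

end IsZeroDegreeSymbol

section Fourier

open scoped RealInnerProductSpace

variable {V : Type*} [NormedAddCommGroup V] [InnerProductSpace ℝ V] [FiniteDimensional ℝ V]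
  [MeasurableSpace V] [BorelSpace V]
  {E : Type*} [NormedAddCommGroup E] [NormedSpace ℂ E]

theorem integral_fourier_smul_eq [CompleteSpace E] {f : V → ℂ} {g : V → E} (hf : Integrable f)
    (hg : Integrable g) : ∫ ξ, 𝓕 f ξ • g ξ = ∫ x, f x • 𝓕 g x := by
  have h := VectorFourier.integral_fourierIntegral_smul_eq_flip (L := innerₗ V)
    Real.continuous_fourierChar continuous_inner hf hg
  rwa [flip_innerₗ] at h

theorem integral_smul_fourierInv_eq [CompleteSpace E] {f : V → ℂ} {g : V → E} (hf : Integrable f)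
    (hg : Integrable g) : ∫ ξ, f ξ • 𝓕⁻ g ξ = ∫ x, 𝓕⁻ f x • g x := by
  calc ∫ ξ, f ξ • 𝓕⁻ g ξ = ∫ ξ, 𝓕 f ξ • g (-ξ) := by
        rw [Real.fourierInv_eq_fourier_comp_neg, integral_fourier_smul_eq hf hg.comp_neg]
    _ = ∫ ξ, 𝓕⁻ f ξ • g ξ := by
        rw [← integral_neg_eq_self]
        simp only [neg_neg, Real.fourierInv_eq_fourier_neg]

theorem fourierInv_fourierChar_smul (v : V → E) (x y : V) :
    𝓕⁻ (fun ξ ↦ Real.fourierChar (-⟪ξ, y⟫) • v ξ) x = 𝓕⁻ v (x - y) := by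
  rw [Real.fourierInv_eq, Real.fourierInv_eq]
  congr! 2 with ξ
  rw [smul_smul, ← AddChar.map_add_eq_mul, inner_sub_right, sub_eq_add_neg]

theorem fourier_mul_fourierInv {v φ : V → ℂ} (hv : Integrable v) (hφ : Integrable φ) (y : V) :
    𝓕 (fun ξ ↦ v ξ * 𝓕⁻ φ ξ) y = ∫ x, 𝓕⁻ v (x - y) * φ x :=
  calc 𝓕 (fun ξ ↦ v ξ * 𝓕⁻ φ ξ) y
      = ∫ ξ, (Real.fourierChar (-⟪ξ, y⟫) • v ξ) * 𝓕⁻ φ ξ := by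
        rw [Real.fourier_eq]
        simp only [smul_mul_assoc]
    _ = ∫ x, 𝓕⁻ (fun ξ ↦ Real.fourierChar (-⟪ξ, y⟫) • v ξ) x * φ x :=
        integral_smul_fourierInv_eq ((Real.fourierIntegral_convergent_iff y).mpr hv) hφ
    _ = ∫ x, 𝓕⁻ v (x - y) * φ x := by simp only [fourierInv_fourierChar_smul]

theorem fourierInv_comp_smul (p : V → E) {r : ℝ} (hr : 0 < r) (x : V) :
    𝓕⁻ (fun ξ ↦ p (r • ξ)) x = (r⁻¹ ^ Module.finrank ℝ V) • 𝓕⁻ p (r⁻¹ • x) := by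
  have h := Measure.integral_comp_smul volume
    (fun ξ : V ↦ Real.fourierChar ⟪ξ, r⁻¹ • x⟫ • p ξ) r
  rw [abs_of_pos (by positivity), ← inv_pow] at h
  rw [Real.fourierInv_eq, Real.fourierInv_eq, ← h]
  congr! 2 with ξ
  rw [real_inner_smul_left, real_inner_smul_right, mul_inv_cancel_left₀ hr.ne']

theorem fourier_tsum {ι : Type*} [Countable ι] {F : ι → V → E}
    (hF : ∀ n, AEStronglyMeasurable (F n)) (hsum : ∑' n, ∫⁻ ξ, ‖F n ξ‖ₑ ≠ ⊤) (y : V) :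
    𝓕 (fun ξ ↦ ∑' n, F n ξ) y = ∑' n, 𝓕 (F n) y := by
  have hchar : Continuous fun ξ : V ↦ Real.fourierChar (-⟪ξ, y⟫) :=
    Real.continuous_fourierChar.comp (by fun_prop)
  simp only [Real.fourier_eq]
  rw [← integral_tsum]
  · simp only [tsum_const_smul']
  · exact fun n ↦ hchar.aestronglyMeasurable.smul (hF n)
  · simpa only [← ofReal_norm, Circle.norm_smul] using hsum

end Fourier

theorem tsum_lintegral_enorm_mul_ne_top {α ι : Type*} [MeasurableSpace α] {μ : Measure α}
    [Countable ι] {F : ι → α → ℂ} {φ : α → ℂ} {B : ℝ≥0∞} (hF : ∀ n, AEStronglyMeasurable (F n) μ)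
    (hφ : Integrable φ μ) (hB : B ≠ ⊤) (h : ∀ x, φ x ≠ 0 → ∑' n, ‖F n x‖ₑ ≤ B) :
    ∑' n, ∫⁻ x, ‖F n x * φ x‖ₑ ∂μ ≠ ⊤ := by
  have hmeas (n : ι) : AEMeasurable (fun x ↦ ‖F n x * φ x‖ₑ) μ :=
    ((hF n).mul hφ.aestronglyMeasurable).enorm
  rw [← lintegral_tsum hmeas]
  refine ne_top_of_le_ne_top (ENNReal.mul_ne_top hB hφ.hasFiniteIntegral.ne) ?_
  rw [← lintegral_const_mul'' B hφ.aestronglyMeasurable.enorm]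
  refine lintegral_mono fun x ↦ ?_
  simp only [enorm_mul, ENNReal.tsum_mul_right]
  by_cases hx : φ x = 0
  · simp [hx]
  · gcongr
    exact h x hx

section Kernel

variable {V : Type*} [NormedAddCommGroup V] [InnerProductSpace ℝ V] [FiniteDimensional ℝ V]
  [MeasurableSpace V] [BorelSpace V]

/-- Away from the origin, the inverse Fourier transform of the symbol `m` is the function `K`, which
has the size of a Calderón–Zygmund kernel with constant `C`. The value `K 0` and point masses at the
origin are not determined: the formula for the multiplier is required only off the support of the
test function. -/
structure IsOffDiagonalKernel (m K : V → ℂ) (C : ℝ≥0) : Prop where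
  aestronglyMeasurable : AEStronglyMeasurable K
  enorm_le : ∀ x, ‖K x‖ₑ ≤ C * ‖x‖ₑ⁻¹ ^ Module.finrank ℝ V
  fourier_mul_fourierInv : ∀ (φ : 𝓢(V, ℂ)) (y : V), y ∉ tsupport φ →
    𝓕 (fun ξ ↦ m ξ * (𝓕⁻ φ) ξ) y = ∫ x, K (x - y) * φ x

/-- The inverse Fourier transform of the `n`-th summand of a dyadic decomposition
`∑ₙ p (2ⁿ ξ)` of a symbol. -/
noncomputable def dyadicPiece (p : 𝓢(V, ℂ)) (n : ℤ) : V → ℂ :=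
  𝓕⁻ fun ξ ↦ p ((2 : ℝ) ^ n • ξ)

/-- The kernel of a symbol with dyadic decomposition `∑ₙ p (2ⁿ ξ)`. The series converges absolutely
for `x ≠ 0`; its value at `0` is irrelevant. -/
noncomputable def dyadicKernel (p : 𝓢(V, ℂ)) (x : V) : ℂ :=
  ∑' n : ℤ, dyadicPiece p n x

theorem dyadicPiece_eq (p : 𝓢(V, ℂ)) (n : ℤ) (x : V) :
    dyadicPiece p n x =
      (((2 : ℝ) ^ n)⁻¹ ^ Module.finrank ℝ V) • (𝓕⁻ p) (((2 : ℝ) ^ n)⁻¹ • x) := by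
  rw [dyadicPiece, fourierInv_comp_smul p (zpow_pos two_pos n), SchwartzMap.fourierInv_coe]

theorem continuous_dyadicPiece (p : 𝓢(V, ℂ)) (n : ℤ) : Continuous (dyadicPiece p n) := by
  rw [funext (dyadicPiece_eq p n)]
  fun_prop

variable [Nontrivial V]

theorem fourier_mul_eq_tsum {m : V → ℂ} {p : 𝓢(V, ℂ)} {A : ℝ}
    (hp : ∀ ξ, ‖p ξ‖ ≤ A * min ‖ξ‖ ‖ξ‖⁻¹)
    (hm : ∀ ξ ≠ 0, HasSum (fun n : ℤ ↦ p ((2 : ℝ) ^ n • ξ)) (m ξ)) {ψ : V → ℂ}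
    (hψ : Integrable ψ) (y : V) :
    𝓕 (fun ξ ↦ m ξ * ψ ξ) y = ∑' n : ℤ, 𝓕 (fun ξ ↦ p ((2 : ℝ) ^ n • ξ) * ψ ξ) y := by
  have hmeas (n : ℤ) : AEStronglyMeasurable fun ξ : V ↦ p ((2 : ℝ) ^ n • ξ) := by fun_prop
  have hbound (ξ : V) : ∑' n : ℤ, ‖p ((2 : ℝ) ^ n • ξ)‖ₑ ≤ 6 * ENNReal.ofReal A := by
    simpa using enorm_pow_mul_tsum_enorm_dilate_le (a := p) (d := 0) (by simpa using hp) ξ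
  calc 𝓕 (fun ξ ↦ m ξ * ψ ξ) y = 𝓕 (fun ξ ↦ ∑' n : ℤ, p ((2 : ℝ) ^ n • ξ) * ψ ξ) y := by
        refine Real.fourier_congr_ae ?_ y
        filter_upwards [Measure.ae_ne volume 0] with ξ hξ
        rw [tsum_mul_right, (hm ξ hξ).tsum_eq]
    _ = ∑' n : ℤ, 𝓕 (fun ξ ↦ p ((2 : ℝ) ^ n • ξ) * ψ ξ) y :=
        fourier_tsum (fun n ↦ (hmeas n).mul hψ.aestronglyMeasurable)
          (tsum_lintegral_enorm_mul_ne_top hmeas hψ (by finiteness) fun ξ _ ↦ hbound ξ) y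

theorem exists_tsum_enorm_dyadicPiece_le (p : 𝓢(V, ℂ)) :
    ∃ C : ℝ≥0, 0 < C ∧
      ∀ x, ∑' n : ℤ, ‖dyadicPiece p n x‖ₑ ≤ C * ‖x‖ₑ⁻¹ ^ Module.finrank ℝ V := by
  obtain ⟨A, hA, hdecay⟩ :=
    exists_norm_pow_mul_le_min (𝓕⁻ p) (Module.finrank_pos (R := ℝ) (M := V)).ne'
  refine ⟨6 * A.toNNReal, mul_pos (by norm_num) (Real.toNNReal_pos.mpr hA), fun x ↦ ?_⟩
  have hreindex : ∑' n : ℤ, ‖dyadicPiece p n x‖ₑ =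
      ∑' n : ℤ, ‖((2 : ℝ) ^ n) ^ Module.finrank ℝ V • (𝓕⁻ p) ((2 : ℝ) ^ n • x)‖ₑ := by
    rw [← (Equiv.neg ℤ).tsum_eq]
    simp only [Equiv.neg_apply, dyadicPiece_eq, zpow_neg, inv_inv]
  have hC : ((6 * A.toNNReal : ℝ≥0) : ℝ≥0∞) = 6 * ENNReal.ofReal A := by
    rw [ENNReal.coe_mul]; rfl
  rw [hreindex, hC, ← ENNReal.inv_pow, ← div_eq_mul_inv, ENNReal.le_div_iff_mul_le
    (.inr (by simpa using hA)) (.inl (by finiteness)), mul_comm]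
  exact enorm_pow_mul_tsum_enorm_dilate_le hdecay x

theorem aestronglyMeasurable_dyadicKernel (p : 𝓢(V, ℂ)) :
    AEStronglyMeasurable (dyadicKernel p) := by
  obtain ⟨C, -, hC⟩ := exists_tsum_enorm_dyadicPiece_le p
  refine aestronglyMeasurable_of_tendsto_ae (atTop : Filter (Finset ℤ))
    (f := fun s x ↦ ∑ n ∈ s, dyadicPiece p n x) (fun s ↦ (continuous_finsetSum s fun n _ ↦
      continuous_dyadicPiece p n).aestronglyMeasurable) ?_
  filter_upwards [Measure.ae_ne volume 0] with x hx
  have hsum : Summable fun n : ℤ ↦ ‖dyadicPiece p n x‖ :=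
    tsum_enorm_ne_top_iff_summable_norm.mp
      (ne_top_of_le_ne_top (by finiteness [enorm_ne_zero.mpr hx]) (hC x))
  exact hsum.of_norm.hasSum

theorem tsum_integral_dyadicPiece_sub_mul (p : 𝓢(V, ℂ)) {φ : V → ℂ} (hφ : Integrable φ) {y : V}
    (hy : y ∉ tsupport φ) :
    ∑' n : ℤ, ∫ x, dyadicPiece p n (x - y) * φ x = ∫ x, dyadicKernel p (x - y) * φ x := by
  obtain ⟨C, -, hC⟩ := exists_tsum_enorm_dyadicPiece_le p
  have hmeas (n : ℤ) : AEStronglyMeasurable fun x : V ↦ dyadicPiece p n (x - y) :=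
    ((continuous_dyadicPiece p n).comp (continuous_sub_right y)).aestronglyMeasurable
  have hbound (x : V) (hx : φ x ≠ 0) : ∑' n : ℤ, ‖dyadicPiece p n (x - y)‖ₑ ≤
      C * (Metric.infEDist y (tsupport φ))⁻¹ ^ Module.finrank ℝ V := by
    refine (hC (x - y)).trans ?_
    gcongr
    rw [← edist_eq_enorm_sub, edist_comm]
    exact Metric.infEDist_le_edist_of_mem (subset_tsupport φ hx)
  have hdist : Metric.infEDist y (tsupport φ) ≠ 0 := fun h ↦
    hy ((Metric.mem_iff_infEDist_zero_of_closed (isClosed_tsupport φ)).mpr h)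
  rw [← integral_tsum]
  · simp only [tsum_mul_right, dyadicKernel]
  · exact fun n ↦ (hmeas n).mul hφ.aestronglyMeasurable
  · exact tsum_lintegral_enorm_mul_ne_top hmeas hφ (by finiteness) hbound

theorem exists_isOffDiagonalKernel_dyadicKernel {m : V → ℂ} {p : 𝓢(V, ℂ)} {A : ℝ}
    (hp : ∀ ξ, ‖p ξ‖ ≤ A * min ‖ξ‖ ‖ξ‖⁻¹)
    (hm : ∀ ξ ≠ 0, HasSum (fun n : ℤ ↦ p ((2 : ℝ) ^ n • ξ)) (m ξ)) :
    ∃ C : ℝ≥0, 0 < C ∧ IsOffDiagonalKernel m (dyadicKernel p) C := by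
  obtain ⟨C, hC₀, hC⟩ := exists_tsum_enorm_dyadicPiece_le p
  refine ⟨C, hC₀, aestronglyMeasurable_dyadicKernel p,
    fun x ↦ enorm_tsum_le_tsum_enorm.trans (hC x), fun φ y hy ↦ ?_⟩
  have hint (n : ℤ) : Integrable fun ξ : V ↦ p ((2 : ℝ) ^ n • ξ) :=
    (integrable_comp_smul_iff volume _ (zpow_pos two_pos n).ne').mpr p.integrable
  calc 𝓕 (fun ξ ↦ m ξ * (𝓕⁻ φ) ξ) y
      = ∑' n : ℤ, 𝓕 (fun ξ ↦ p ((2 : ℝ) ^ n • ξ) * (𝓕⁻ φ) ξ) y :=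
        fourier_mul_eq_tsum hp hm (𝓕⁻ φ).integrable y
    _ = ∑' n : ℤ, ∫ x, dyadicPiece p n (x - y) * φ x := by
        simp only [SchwartzMap.fourierInv_coe, fourier_mul_fourierInv (hint _) φ.integrable,
          dyadicPiece]
    _ = ∫ x, dyadicKernel p (x - y) * φ x := tsum_integral_dyadicPiece_sub_mul p φ.integrable hy

end Kernel

section Convolution

open scoped Convolution

variable {G : Type*} [NormedAddCommGroup G] [MeasurableSpace G] {μ : Measure G}
  {f g K : G → ℂ} {s t : Set G} {C : ℝ≥0} {d : ℕ}

theorem enorm_convolution_le (hK : ∀ x, ‖K x‖ₑ ≤ C * ‖x‖ₑ⁻¹ ^ d)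
    (hf : AEStronglyMeasurable f μ) (hfs : ∀ᵐ y ∂μ, y ∉ s → f y = 0) (x : G) :
    ‖(f ⋆[.mul ℂ ℂ, μ] K) x‖ₑ ≤ C * (Metric.infEDist x s)⁻¹ ^ d * eLpNorm f 1 μ := by
  rw [eLpNorm_one_eq_lintegral_enorm, ← lintegral_const_mul'' _ hf.enorm]
  refine (enorm_integral_le_lintegral_enorm _).trans (lintegral_mono_ae ?_)
  filter_upwards [hfs] with y hy
  by_cases hys : y ∈ s
  · rw [ContinuousLinearMap.mul_apply', enorm_mul, mul_comm]
    gcongr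
    refine (hK (x - y)).trans ?_
    gcongr
    rw [← edist_eq_enorm_sub]
    exact Metric.infEDist_le_edist_of_mem hys
  · simp [hy hys]

theorem lintegral_enorm_convolution_mul_le (hK : ∀ x, ‖K x‖ₑ ≤ C * ‖x‖ₑ⁻¹ ^ d)
    (hf : AEStronglyMeasurable f μ) (hfs : ∀ᵐ y ∂μ, y ∉ s → f y = 0)
    (hg : AEStronglyMeasurable g μ) (hgt : ∀ᵐ x ∂μ, x ∉ t → g x = 0) {δ : ℝ≥0∞}
    (hδ : ∀ y ∈ s, ∀ x ∈ t, δ ≤ edist y x) :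
    ∫⁻ x, ‖(f ⋆[.mul ℂ ℂ, μ] K) x * g x‖ₑ ∂μ ≤
      C * δ⁻¹ ^ d * eLpNorm g 1 μ * eLpNorm f 1 μ := by
  rw [mul_right_comm, eLpNorm_one_eq_lintegral_enorm (f := g), ← lintegral_const_mul'' _ hg.enorm]
  refine lintegral_mono_ae ?_
  filter_upwards [hgt] with x hx
  by_cases hxt : x ∈ t
  · rw [enorm_mul]
    gcongr
    refine (enorm_convolution_le hK hf hfs x).trans ?_
    gcongr
    exact Metric.le_infEDist.mpr fun y hy ↦ edist_comm x y ▸ hδ y hy x hxt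
  · simp [hx hxt]

variable [BorelSpace G] [SecondCountableTopology G] [SFinite μ]
  [μ.IsAddRightInvariant]

theorem aestronglyMeasurable_convolution (hf : AEStronglyMeasurable f μ)
    (hKm : AEStronglyMeasurable K μ) : AEStronglyMeasurable (f ⋆[.mul ℂ ℂ, μ] K) μ :=
  (hf.convolution_integrand _ hKm).integral_prod_right'

theorem locallyIntegrableOn_convolution [IsLocallyFiniteMeasure μ]
    (hKm : AEStronglyMeasurable K μ) (hK : ∀ x, ‖K x‖ₑ ≤ C * ‖x‖ₑ⁻¹ ^ d)
    (hf : Integrable f μ) (hs : IsClosed s) (hfs : ∀ᵐ y ∂μ, y ∉ s → f y = 0) :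
    LocallyIntegrableOn (f ⋆[.mul ℂ ℂ, μ] K) sᶜ μ := by
  intro x hx
  have hmeas := aestronglyMeasurable_convolution hf.aestronglyMeasurable hKm
  have hpos : Metric.infEDist x s ≠ 0 := fun h ↦
    hx ((Metric.mem_iff_infEDist_zero_of_closed hs).mpr h)
  have hnorm : eLpNorm f 1 μ ≠ ⊤ := (memLp_one_iff_integrable.mpr hf).eLpNorm_ne_top
  have hcont : Continuous fun z ↦ C * (Metric.infEDist z s)⁻¹ ^ d * eLpNorm f 1 μ :=
    (ENNReal.continuous_mul_const hnorm).comp <| (ENNReal.continuous_const_mul (by finiteness)).comp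
      ((ENNReal.continuous_pow d).comp Metric.continuous_infEDist.inv)
  obtain ⟨M, hM, -⟩ := ENNReal.lt_iff_exists_nnreal_btwn.mp
    (show C * (Metric.infEDist x s)⁻¹ ^ d * eLpNorm f 1 μ < ⊤ by finiteness)
  refine ((μ.finiteAt_nhds x).integrableAtFilter hmeas.stronglyMeasurableAtFilter
    ⟨M, eventually_map.mpr ?_⟩).filter_mono nhdsWithin_le_nhds
  filter_upwards [hcont.continuousAt.eventually_lt_const hM] with z hz
  exact enorm_le_coe.mp <|
    (enorm_convolution_le hK hf.aestronglyMeasurable hfs z).trans hz.le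

theorem integrable_convolution_integrand_mul {φ : G → ℂ}
    (hKm : AEStronglyMeasurable K μ) (hK : ∀ x, ‖K x‖ₑ ≤ C * ‖x‖ₑ⁻¹ ^ d)
    (hf : Integrable f μ) (hs : IsClosed s) (hfs : ∀ᵐ y ∂μ, y ∉ s → f y = 0)
    (hφ : Integrable φ μ) (hφc : HasCompactSupport φ) (hφs : Disjoint (tsupport φ) s) :
    Integrable (fun z : G × G ↦ f z.2 * K (z.1 - z.2) * φ z.1) (μ.prod μ) := by
  obtain ⟨δ, hδ, hdist⟩ := Metric.exists_pos_forall_lt_edist hφc.isCompact hs hφs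
  have hprod := hφ.mul_prod hf
  refine ⟨(hf.aestronglyMeasurable.convolution_integrand (.mul ℂ ℂ) hKm).mul
    hφ.aestronglyMeasurable.comp_fst, lt_of_le_of_lt ?_ (ENNReal.mul_lt_top
      (show C * (δ : ℝ≥0∞)⁻¹ ^ d < ⊤ by finiteness [hδ.ne']) hprod.hasFiniteIntegral)⟩
  rw [← lintegral_const_mul'' _ hprod.aestronglyMeasurable.enorm]
  refine lintegral_mono_ae ?_
  filter_upwards [Measure.quasiMeasurePreserving_snd.ae hfs] with ⟨x, y⟩ hy
  by_cases h : y ∈ s ∧ φ x ≠ 0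
  · have hKδ : ‖K (x - y)‖ₑ ≤ C * (δ : ℝ≥0∞)⁻¹ ^ d := by
      refine (hK (x - y)).trans ?_
      gcongr
      rw [← edist_eq_enorm_sub]
      exact (hdist x (subset_tsupport φ h.2) y h.1).le
    calc ‖f y * K (x - y) * φ x‖ₑ = ‖K (x - y)‖ₑ * ‖φ x * f y‖ₑ := by
          simp only [enorm_mul]
          ring
      _ ≤ C * (δ : ℝ≥0∞)⁻¹ ^ d * ‖φ x * f y‖ₑ := by gcongr
  · obtain hys | hx := not_and_or.mp h
    · simp [hy hys]
    · simp [not_not.mp hx]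

theorem integral_mul_integral_kernel_sub_mul {φ : G → ℂ}
    (hKm : AEStronglyMeasurable K μ) (hK : ∀ x, ‖K x‖ₑ ≤ C * ‖x‖ₑ⁻¹ ^ d)
    (hf : Integrable f μ) (hs : IsClosed s) (hfs : ∀ᵐ y ∂μ, y ∉ s → f y = 0)
    (hφ : Integrable φ μ) (hφc : HasCompactSupport φ) (hφs : Disjoint (tsupport φ) s) :
    ∫ y, f y * ∫ x, K (x - y) * φ x ∂μ ∂μ = ∫ x, (f ⋆[.mul ℂ ℂ, μ] K) x * φ x ∂μ := by
  calc ∫ y, f y * ∫ x, K (x - y) * φ x ∂μ ∂μ = ∫ y, ∫ x, f y * K (x - y) * φ x ∂μ ∂μ := by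
        simp only [mul_assoc, integral_const_mul]
    _ = ∫ x, ∫ y, f y * K (x - y) * φ x ∂μ ∂μ := (integral_integral_swap
        (integrable_convolution_integrand_mul hKm hK hf hs hfs hφ hφc hφs)).symm
    _ = ∫ x, (f ⋆[.mul ℂ ℂ, μ] K) x * φ x ∂μ := by
        simp only [integral_mul_const, convolution_def, ContinuousLinearMap.mul_apply']

end Convolution

section Support

variable {f : R3 → ℂ} {s t : Set R3}

theorem notMem_essSupport {x : R3} :
    x ∉ essSupport f ↔ ∃ U ∈ 𝓝 x, f =ᵐ[volume.restrict U] 0 := by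
  simp only [essSupport, Set.mem_ofPred_eq, not_forall, not_not, exists_prop]

theorem isClosed_essSupport (f : R3 → ℂ) : IsClosed (essSupport f) := by
  refine isOpen_compl_iff.mp (isOpen_iff_mem_nhds.mpr fun x hx ↦ ?_)
  obtain ⟨U, hU, hfU⟩ := notMem_essSupport.mp hx
  filter_upwards [eventually_mem_nhds_iff.mpr hU] with y hy
  exact notMem_essSupport.mpr ⟨U, hy, hfU⟩

theorem ae_eq_zero_of_notMem_essSupport (f : R3 → ℂ) :
    ∀ᵐ x, x ∉ essSupport f → f x = 0 := by
  refine measure_null_of_locally_null _ fun x hx ↦ ?_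
  obtain ⟨hxf, -⟩ := Classical.not_imp.mp hx
  obtain ⟨U, hU, hfU⟩ := notMem_essSupport.mp hxf
  refine ⟨_, inter_mem_nhdsWithin _ hU, measure_mono_null ?_
    (le_antisymm ((Measure.le_restrict_apply U {x | f x ≠ 0}).trans (ae_iff.mp hfU).le) zero_le)⟩
  exact Set.inter_subset_inter_left U fun y hy ↦ (Classical.not_imp.mp hy).2

theorem setEDist_le_edist {x y : R3} (hx : x ∈ s) (hy : y ∈ t) : setEDist s t ≤ edist x y :=
  (iInf₂_le x hx).trans (iInf₂_le y hy)

theorem disjoint_of_setEDist_pos (h : 0 < setEDist s t) : Disjoint s t :=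
  Set.disjoint_left.mpr fun x hxs hxt ↦ h.not_ge (edist_self x ▸ setEDist_le_edist hxs hxt)

end Support

section Pairing

variable {u : 𝓢'(R3, ℂ)} {h₁ h₂ : R3 → ℂ} {U V : Set R3}

theorem RepresentedOn.integral_smul_eq (H₁ : RepresentedOn u h₁ U) (H₂ : RepresentedOn u h₂ V)
    {g : R3 → ℝ} (hg : ContDiff ℝ ∞ g) (hgc : HasCompactSupport g) (hgU : tsupport g ⊆ U)
    (hgV : tsupport g ⊆ V) : ∫ x, g x • h₁ x = ∫ x, g x • h₂ x := by
  have hc : HasCompactSupport fun x ↦ (g x : ℂ) := hgc.comp_left Complex.ofReal_zero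
  have hsupp : tsupport (fun x ↦ (g x : ℂ)) ⊆ tsupport g :=
    closure_mono (Function.support_comp_subset Complex.ofReal_zero g)
  let φ : 𝓢(R3, ℂ) := hc.toSchwartzMap (Complex.ofRealCLM.contDiff.comp hg)
  have hφ (h : R3 → ℂ) : ∫ x, g x • h x = ∫ x, h x * φ x :=
    integral_congr_ae (.of_forall fun x ↦ mul_comm (g x : ℂ) (h x))
  rw [hφ, hφ, ← H₁.2 φ hc (hsupp.trans hgU), ← H₂.2 φ hc (hsupp.trans hgV)]

theorem integrable_smul_of_tsupport_subset {h : R3 → ℂ} (hh : LocallyIntegrableOn h U)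
    {g : R3 → ℝ} (hg : Continuous g) (hgc : HasCompactSupport g) (hgU : tsupport g ⊆ U) :
    Integrable fun x ↦ g x • h x := by
  have hon : IntegrableOn (fun x ↦ g x • h x) (tsupport g) :=
    (hh.integrableOn_compact_subset hgU hgc.isCompact).continuousOn_smul hg.continuousOn
      hgc.isCompact
  exact (integrableOn_iff_integrable_of_support_subset
    ((Function.support_smul_subset_left g h).trans (subset_tsupport g))).mp hon

theorem RepresentedOn.ae_eq (H₁ : RepresentedOn u h₁ U) (H₂ : RepresentedOn u h₂ V)
    (hU : IsOpen U) (hV : IsOpen V) : ∀ᵐ x, x ∈ U ∩ V → h₁ x = h₂ x := by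
  have hloc₁ : LocallyIntegrableOn h₁ (U ∩ V) := H₁.1.mono_set Set.inter_subset_left
  have hloc₂ : LocallyIntegrableOn h₂ (U ∩ V) := H₂.1.mono_set Set.inter_subset_right
  have hzero := (hU.inter hV).ae_eq_zero_of_integral_contDiff_smul_eq_zero (hloc₁.sub hloc₂)
    fun g hg hgc hgUV ↦ by
      simp only [Pi.sub_apply, smul_sub]
      rw [integral_sub (integrable_smul_of_tsupport_subset hloc₁ hg.continuous hgc hgUV)
        (integrable_smul_of_tsupport_subset hloc₂ hg.continuous hgc hgUV), sub_eq_zero]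
      exact H₁.integral_smul_eq H₂ hg hgc (hgUV.trans Set.inter_subset_left)
        (hgUV.trans Set.inter_subset_right)
  filter_upwards [hzero] with x hx hxUV
  exact sub_eq_zero.mp (hx hxUV)

theorem HasPairing.eq_integral {g : R3 → ℂ} {z : ℂ} (H : HasPairing u g z)
    (hrep : RepresentedOn u h₂ V) (hV : IsOpen V) (hgV : essSupport g ⊆ V) :
    z = ∫ x, h₂ x * g x := by
  obtain ⟨U, h, hU, hgU, hrepU, -, rfl⟩ := H
  refine integral_congr_ae ?_
  filter_upwards [hrepU.ae_eq hrep hU hV, ae_eq_zero_of_notMem_essSupport g] with x heq hzero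
  by_cases hx : x ∈ essSupport g
  · rw [heq ⟨hgU hx, hgV hx⟩]
  · rw [hzero hx, mul_zero, mul_zero]

end Pairing

section Multiplier

open scoped Convolution

variable {m K f : R3 → ℂ} {C : ℝ≥0}

theorem IsZeroDegreeSymbol.exists_isOffDiagonalKernel (hm : IsZeroDegreeSymbol m) :
    ∃ (K : R3 → ℂ) (C : ℝ≥0), 0 < C ∧ IsOffDiagonalKernel m K C := by
  obtain ⟨p, A, hp, hsum⟩ := hm.exists_dyadic_decomposition
  obtain ⟨C, hC, hK⟩ := exists_isOffDiagonalKernel_dyadicKernel hp hsum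
  exact ⟨dyadicKernel p, C, hC, hK⟩

theorem multiplierOp_apply (hm : IsZeroDegreeSymbol m) (hf : Integrable f) (φ : 𝓢(R3, ℂ)) :
    multiplierOp m hm f hf φ = ∫ y, f y * 𝓕 (fun ξ ↦ m ξ * (𝓕⁻ φ) ξ) y := by
  have hint : Integrable fun ξ ↦ m ξ * (𝓕⁻ φ : 𝓢(R3, ℂ)) ξ :=
    (𝓕⁻ φ : 𝓢(R3, ℂ)).integrable.mul_of_top_right hm.memLp_top
  rw [multiplierOp, TemperedDistribution.fourierInv_apply, Lp.toTemperedDistribution_apply]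
  refine Eq.trans (integral_congr_ae ?_) (integral_fourier_smul_eq hf hint)
  filter_upwards [(hm.memLp_mul_fourier hf).coeFn_toLp] with ξ hξ
  rw [hξ, smul_eq_mul, smul_eq_mul]
  ring

theorem representedOn_convolution (hK : IsOffDiagonalKernel m K C) (hm : IsZeroDegreeSymbol m)
    (hf : Integrable f) :
    RepresentedOn (multiplierOp m hm f hf) (f ⋆[.mul ℂ ℂ, volume] K) (essSupport f)ᶜ := by
  have hclosed := isClosed_essSupport f
  have hzero := ae_eq_zero_of_notMem_essSupport f
  refine ⟨locallyIntegrableOn_convolution hK.aestronglyMeasurable hK.enorm_le hf hclosed hzero,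
    fun φ hφc hφs ↦ ?_⟩
  rw [multiplierOp_apply, ← integral_mul_integral_kernel_sub_mul hK.aestronglyMeasurable
    hK.enorm_le hf hclosed hzero φ.integrable hφc (Set.subset_compl_iff_disjoint_right.mp hφs)]
  refine integral_congr_ae ?_
  filter_upwards [hzero] with y hy
  by_cases hys : y ∈ essSupport f
  · rw [hK.fourier_mul_fourierInv φ y fun h ↦ hφs h hys]
  · rw [hy hys, zero_mul, zero_mul]

theorem exists_pairing_bound (hm : IsZeroDegreeSymbol m) :
    ∃ C : ℝ≥0, 0 < C ∧ ∀ (f g : R3 → ℂ) (hf : Integrable f), Integrable g →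
      Disjoint (essSupport f) (essSupport g) →
        (0 < setEDist (essSupport f) (essSupport g) →
          ∃ z : ℂ, HasPairing (multiplierOp m hm f hf) g z) ∧
        ∀ z : ℂ, HasPairing (multiplierOp m hm f hf) g z →
          ‖z‖ₑ ≤ C * (setEDist (essSupport f) (essSupport g))⁻¹ ^ 3 *
            eLpNorm g 1 volume * eLpNorm f 1 volume := by
  obtain ⟨K, C, hC, hK⟩ := hm.exists_isOffDiagonalKernel
  refine ⟨C, hC, fun f g hf hg hfg ↦ ?_⟩
  have hrep := representedOn_convolution hK hm hf
  have hopen := (isClosed_essSupport f).isOpen_compl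
  have hsub : essSupport g ⊆ (essSupport f)ᶜ := hfg.subset_compl_left
  have hbound : ∫⁻ x, ‖(f ⋆[.mul ℂ ℂ, volume] K) x * g x‖ₑ ≤
      C * (setEDist (essSupport f) (essSupport g))⁻¹ ^ 3 *
        eLpNorm g 1 volume * eLpNorm f 1 volume := by
    simpa only [finrank_euclideanSpace_fin] using lintegral_enorm_convolution_mul_le hK.enorm_le
      hf.aestronglyMeasurable (ae_eq_zero_of_notMem_essSupport f) hg.aestronglyMeasurable
      (ae_eq_zero_of_notMem_essSupport g) fun y hy x hx ↦ setEDist_le_edist hy hx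
  refine ⟨fun hd ↦ ?_, fun z hz ↦ ?_⟩
  · have hmeas := (aestronglyMeasurable_convolution hf.aestronglyMeasurable
      hK.aestronglyMeasurable).mul hg.aestronglyMeasurable
    have hf1 := (memLp_one_iff_integrable.mpr hf).eLpNorm_ne_top
    have hg1 := (memLp_one_iff_integrable.mpr hg).eLpNorm_ne_top
    exact ⟨_, _, _, hopen, hsub, hrep,
      ⟨hmeas, hbound.trans_lt (by finiteness [hd.ne'])⟩, rfl⟩
  · rw [hz.eq_integral hrep hopen hsub]
    exact (enorm_integral_le_lintegral_enorm _).trans hbound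

end Multiplier

section Cylinder

theorem lipschitzWith_cylRadius : LipschitzWith 1 cylRadius := by
  have hnorm (x : R3) : cylRadius x = ‖(⟨x 0, x 1⟩ : ℂ)‖ :=
    (Complex.norm_eq_sqrt_sq_add_sq ⟨x 0, x 1⟩).symm
  refine LipschitzWith.of_dist_le_mul fun x y ↦ ?_
  rw [NNReal.coe_one, one_mul, hnorm, hnorm]
  refine (dist_norm_norm_le _ _).trans ?_
  rw [EuclideanSpace.dist_eq, Complex.norm_eq_sqrt_sq_add_sq]
  refine Real.sqrt_le_sqrt ?_
  simp only [Fin.sum_univ_three, Complex.sub_re, Complex.sub_im, Real.dist_eq, sq_abs]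
  exact le_add_of_nonneg_right (sq_nonneg _)

theorem ofReal_sub_le_setEDist {s t : Set R3} {a b : ℝ} (hs : s ⊆ {x | b ≤ cylRadius x})
    (ht : t ⊆ {x | cylRadius x ≤ a}) : ENNReal.ofReal (b - a) ≤ setEDist s t := by
  refine le_iInf₂ fun x hx ↦ le_iInf₂ fun y hy ↦ ?_
  calc ENNReal.ofReal (b - a) ≤ ENNReal.ofReal (dist (cylRadius x) (cylRadius y)) :=
        ENNReal.ofReal_le_ofReal ((sub_le_sub (hs hx) (ht hy)).trans (le_abs_self _))
    _ = edist (cylRadius x) (cylRadius y) := (edist_dist _ _).symm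
    _ ≤ edist x y := by simpa using lipschitzWith_cylRadius x y

theorem exists_pairing_bound_of_cylRadius {m : R3 → ℂ} (hm : IsZeroDegreeSymbol m) {d : ℝ}
    (hd : 0 < d) :
    ∃ C : ℝ≥0, 0 < C ∧ ∀ γ₁ γ₂ R : ℝ, γ₂ - γ₁ = d → 0 < R →
      ∀ (f g : R3 → ℂ) (hf : Integrable f), Integrable g →
        essSupport f ⊆ {x | γ₂ * R ≤ cylRadius x} →
        essSupport g ⊆ {x | cylRadius x ≤ γ₁ * R} →
          (∃ z : ℂ, HasPairing (multiplierOp m hm f hf) g z) ∧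
          ∀ z : ℂ, HasPairing (multiplierOp m hm f hf) g z →
            ‖z‖ₑ ≤ C * (ENNReal.ofReal R)⁻¹ ^ 3 *
              eLpNorm g 1 volume * eLpNorm f 1 volume := by
  lift d to ℝ≥0 using hd.le
  rw [NNReal.coe_pos] at hd
  obtain ⟨C, hC, hpair⟩ := exists_pairing_bound hm
  refine ⟨C * d⁻¹ ^ 3, by positivity, fun γ₁ γ₂ R hγ hR f g hf hg hfs hgs ↦ ?_⟩
  have hdist : d * ENNReal.ofReal R ≤ setEDist (essSupport f) (essSupport g) := by
    have h := ofReal_sub_le_setEDist hfs hgs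
    rwa [← sub_mul, hγ, ENNReal.ofReal_mul d.coe_nonneg, ENNReal.ofReal_coe_nnreal] at h
  have hpos : 0 < setEDist (essSupport f) (essSupport g) :=
    (ENNReal.mul_pos (by simpa using hd.ne') (by simpa using hR)).trans_le hdist
  obtain ⟨hdef, hbound⟩ := hpair f g hf hg (disjoint_of_setEDist_pos hpos)
  refine ⟨hdef hpos, fun z hz ↦ (hbound z hz).trans ?_⟩
  gcongr ?_ * _ * _
  calc C * (setEDist (essSupport f) (essSupport g))⁻¹ ^ 3
      ≤ C * (d * ENNReal.ofReal R)⁻¹ ^ 3 := by gcongr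
    _ = ↑(C * d⁻¹ ^ 3) * (ENNReal.ofReal R)⁻¹ ^ 3 := by
        rw [ENNReal.mul_inv (.inr ENNReal.ofReal_ne_top) (.inl ENNReal.coe_ne_top), mul_pow,
          ← mul_assoc, ENNReal.coe_mul, ENNReal.coe_pow, ENNReal.coe_inv hd.ne']

end Cylinder

end ZeroDegree

theorem proposition2p1 :
    -- the general estimate for symbols that are homogeneous of degree zero
    (∀ (m : R3 → ℂ) (hm : IsZeroDegreeSymbol m), ∃ C : ℝ≥0, 0 < C ∧
      ∀ (f g : R3 → ℂ) (hf : Integrable f) (_hg : Integrable g),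
        Disjoint (essSupport f) (essSupport g) →
          (0 < setEDist (essSupport f) (essSupport g) →
            ∃ z : ℂ, HasPairing (multiplierOp m hm f hf) g z) ∧
          ∀ z : ℂ, HasPairing (multiplierOp m hm f hf) g z →
            ‖z‖ₑ ≤ C * ((setEDist (essSupport f) (essSupport g))⁻¹) ^ 3 *
              eLpNorm g 1 volume * eLpNorm f 1 volume) ∧
    -- fourth powers of the Riesz transforms
    (∀ (i : Fin 3) (d : ℝ), 0 < d → ∃ C : ℝ≥0, 0 < C ∧
      ∀ γ₁ γ₂ R : ℝ, 0 < γ₁ → 0 < γ₂ → γ₂ - γ₁ = d → 0 < R →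
      ∀ (f g : R3 → ℂ) (hf : Integrable f) (_hg : Integrable g),
        essSupport f ⊆ {x | γ₂ * R ≤ cylRadius x} →
        essSupport g ⊆ {x | cylRadius x ≤ γ₁ * R} →
          (∃ z : ℂ, HasPairing (multiplierOp (rieszSymbol i ^ 4)
            ((isZeroDegreeSymbol_riesz i).pow 4) f hf) g z) ∧
          ∀ z : ℂ, HasPairing (multiplierOp (rieszSymbol i ^ 4)
            ((isZeroDegreeSymbol_riesz i).pow 4) f hf) g z →
            ‖z‖ₑ ≤ C * ((ENNReal.ofReal R)⁻¹) ^ 3 *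
              eLpNorm g 1 volume * eLpNorm f 1 volume) ∧
    -- products of squares of Riesz transforms
    (∀ (k h : Fin 3) (d : ℝ), 0 < d → ∃ C : ℝ≥0, 0 < C ∧
      ∀ γ₁ γ₂ R : ℝ, 0 < γ₁ → 0 < γ₂ → γ₂ - γ₁ = d → 0 < R →
      ∀ (f g : R3 → ℂ) (hf : Integrable f) (_hg : Integrable g),
        essSupport f ⊆ {x | γ₂ * R ≤ cylRadius x} →
        essSupport g ⊆ {x | cylRadius x ≤ γ₁ * R} →
          (∃ z : ℂ, HasPairing (multiplierOp (rieszSymbol k ^ 2 * rieszSymbol h ^ 2)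
            (((isZeroDegreeSymbol_riesz k).pow 2).mul ((isZeroDegreeSymbol_riesz h).pow 2))
            f hf) g z) ∧
          ∀ z : ℂ, HasPairing (multiplierOp (rieszSymbol k ^ 2 * rieszSymbol h ^ 2)
            (((isZeroDegreeSymbol_riesz k).pow 2).mul ((isZeroDegreeSymbol_riesz h).pow 2))
            f hf) g z →
            ‖z‖ₑ ≤ C * ((ENNReal.ofReal R)⁻¹) ^ 3 *
              eLpNorm g 1 volume * eLpNorm f 1 volume) := by
  refine ⟨fun m hm ↦ exists_pairing_bound hm, fun i d hd ↦ ?_, fun k h d hd ↦ ?_⟩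
  · obtain ⟨C, hC, hbound⟩ :=
      exists_pairing_bound_of_cylRadius ((isZeroDegreeSymbol_riesz i).pow 4) hd
    exact ⟨C, hC, fun γ₁ γ₂ R _ _ ↦ hbound γ₁ γ₂ R⟩
  · obtain ⟨C, hC, hbound⟩ := exists_pairing_bound_of_cylRadius
      (((isZeroDegreeSymbol_riesz k).pow 2).mul ((isZeroDegreeSymbol_riesz h).pow 2)) hd
    exact ⟨C, hC, fun γ₁ γ₂ R _ _ ↦ hbound γ₁ γ₂ R⟩
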